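/- **Setting.** Let $\mathcal V,\mathcal H$ be real Hilbert spaces with $\mathcal V$ densely and continuously embedded into $\mathcal H$; identify $\mathcal H$ with its dual, so that $\mathcal V\hookrightarrow\mathcal H\hookrightarrow\mathcal V'$, and let $\langle\cdot,\cdot\rangle$ be the duality pairing between $\mathcal V'$ and $\mathcal V$. Let $J\ge 1$ and, for $j=1,\dots,J$, let $X_j$ be a metric space with a finite measure $\mu_j$ on a $\sigma$-algebra containing the open sets, $N_j\ge1$, and $U_j$ a closed subspace of $L^2(X_j,\mu_j)^{N_j}$. Let $U=\prod_jU_j$ and let $I_U:\mathcal V\to U$ be a continuous linear map. Let $A_1:\mathcal V\to\mathcal V'$ be bounded and linear with $\langle A_1u,u\rangle=0$ for all $u\in\mathcal V$. Let $\alpha_j\in C([0,\infty)\times X_j;(0,\infty))$ be locally Lipschitz in time (for every $\tau>0$ there is $\kappa(\tau)>0$ with $|\alpha_j(t,x)-\alpha_j(s,x)|\le\kappa(\tau)|t-s|$ for all $s,t\in[0,\tau]$, $x\in X_j$), and let $g_j:\mathbb R^{N_j}\to\mathbb R^{N_j}$ be continuous with $(g_j(x)-g_j(y))\cdot(x-y)\ge0$,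 $g_j(0)=0$ and $|g_j(x)|\le M(1+|x|)$, for a constant $M>0$. Define $B(t):\mathcal V\to\mathcal V'$ by $$\langle B(t)u,v\rangle=\sum_{j=1}^J\int_{X_j}\alpha_j(t,x_j)\,g_j((I_Uu)_j(x_j))\cdot(I_Uv)_j(x_j)\,d\mu_j(x_j),$$ and let $\mathcal A_B(t)v=(A_1+B(t))v$ on $D(\mathcal A_B(t))=\{v\in\mathcal V:(A_1+B(t))v\in\mathcal H\}$. A solution is a function $x\in C([0,\infty),\mathcal H)$ with $x(t)\in D(\mathcal A_B(t))$ for all $t\ge0$ such that, outside a countable set of times, $x'(t)=-\mathcal A_B(t)x(t)$ exists in $\mathcal H$ and is continuous. Its energy is $\mathcal E(t)=\frac12\|x(t)\|_{\mathcal H}^2$. **Assumptions.** (a) Writing $I_U$ also for the operator $\mathcal V\to\mathcal V'$ given by $\langle I_Uu,v\rangle=(I_Uu,I_Uv)_U$, the operator $A_1-I_U$ generates a strongly continuous semigroup of contractions in $\mathcal H$, and $-A_1-I_U$ generates a strongly continuous semigroup of contractions $S(t)$ with $\|S(t)x_0\|_{\mathcal H}\le Ce^{-\omega t}\|x_0\|_{\mathcal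 H}$ for all $t\ge 0$, $x_0\in\mathcal H$, where $C,\omega>0$. (Both operators have as domain the set of $v\in\mathcal V$ that they map into $\mathcal H$.) (b) There are $m>0$ and a continuous, concave, strictly increasing $G:[0,\infty)\to[0,\infty)$ with $G(0)=0$ such that, for all $j$, $g_j(x)\cdot x\ge m|x|^2$ if $|x|\ge1$, and $|x|^2+|g_j(x)|^2\le G(g_j(x)\cdot x)$ if $|x|\le1$. (c) There are constants $\alpha_0,\tilde\alpha>0$ with $\alpha_0\le\alpha_j(t,x_j)\le\tilde\alpha$ for all $t\ge0$, $x_j\in X_j$, $j=1,\dots,J$. **Theorem (oscillating case).** For given $J$, $C$ and $\omega$ there is $T_0>0$ such that for every $T\ge T_0$ there is $c>0$, depending only on $J$, $T$, $C$, $\omega$, $\max_j\mu_j(X_j)$, $\tilde\alpha$, $\alpha_0$, $M$ and $m$, with the following property. Under the above assumptions, $h(x)=c\,(x+G(x))$ is a bijection of $[0,\infty)$; let $p=h^{-1}$ and $\mu=\min_j\mu_j(X_j)$. Let $x$ be any solution. If $\mathcal E(0)>0$, then $\psi(x)=\int_x^{\mathcal E(0)}\frac{ds}{p(s)}$ is well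 defined and strictly decreasing on $(0,\infty)$, its range contains $[0,\infty)$, and $$\mathcal E(t)\le\psi^{-1}\big(T\mu\alpha_0(t-T)\big)\qquad\text{for all }t\ge T.$$ If $\mathcal E(0)=0$, then $\mathcal E(t)=0$ for all $t\ge T$. In particular the bound is the same, with the same $c$, as for any autonomous coefficients $\alpha_j(t,x_j)=\alpha_j(x_j)$ satisfying (c). -/

import Mathlib

open Set Filter Topology MeasureTheory
open scoped InnerProductSpace

noncomputable section

namespace HyperbolicDamping

/-- Data and standing assumptions of the abstract hyperbolic setting with the damping
`⟨B(t)u, v⟩ = ∑ j, ∫ α j t x * (g j ((I_U u) j x) · (I_U v) j x) dμ j(x)`. -/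
structure DampedSystem {J : ℕ} (N : Fin J → ℕ)
    (V H : Type*) [NormedAddCommGroup V] [InnerProductSpace ℝ V] [CompleteSpace V]
    [NormedAddCommGroup H] [InnerProductSpace ℝ H] [CompleteSpace H]
    (X : Fin J → Type*) [∀ j, MetricSpace (X j)] [∀ j, MeasurableSpace (X j)]
    [∀ j, OpensMeasurableSpace (X j)] where
  /-- The dense continuous embedding of `V` into `H`. -/
  ι : V →L[ℝ] H
  ι_injective : Function.Injective ι
  ι_dense : DenseRange ι
  /-- The finite measures on the spaces `X j`. -/
  μ : ∀ j, Measure (X j)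
  μ_finite : ∀ j, IsFiniteMeasure (μ j)
  N_pos : ∀ j, 0 < N j
  /-- The closed subspaces `U j` of `L²(X j, μ j)^(N j)`; the control space is their product. -/
  U : ∀ j, Submodule ℝ (Lp (EuclideanSpace ℝ (Fin (N j))) 2 (μ j))
  U_closed : ∀ j, IsClosed (U j : Set (Lp (EuclideanSpace ℝ (Fin (N j))) 2 (μ j)))
  /-- The continuous linear map `I_U` from `V` to the Hilbert product `U = ∏ j, U j`. -/
  IU : V →L[ℝ] PiLp 2 (fun j => U j)
  /-- The bounded linear operator `A₁` from `V` to its dual. -/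
  A₁ : V →L[ℝ] StrongDual ℝ V
  A₁_skew : ∀ u, A₁ u u = 0
  /-- The time dependent coefficients. -/
  α : ∀ j, ℝ → X j → ℝ
  α_continuous : ∀ j, ContinuousOn (fun q : ℝ × X j => α j q.1 q.2) (Ici 0 ×ˢ univ)
  α_pos : ∀ j t x, 0 ≤ t → 0 < α j t x
  α_lipschitz : ∀ j, ∀ τ > 0, ∃ κ > 0, ∀ s ∈ Icc 0 τ, ∀ t ∈ Icc 0 τ, ∀ x,
    |α j t x - α j s x| ≤ κ * |t - s|
  /-- The nonlinear feedbacks. -/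
  g : ∀ j, EuclideanSpace ℝ (Fin (N j)) → EuclideanSpace ℝ (Fin (N j))
  g_continuous : ∀ j, Continuous (g j)
  g_monotone : ∀ j x y, 0 ≤ ⟪g j x - g j y, x - y⟫_ℝ
  g_zero : ∀ j, g j 0 = 0

/-- `S` (restricted to `t ≥ 0`) is a strongly continuous semigroup of contractions. -/
structure IsContractionSemigroup {H : Type*} [NormedAddCommGroup H] [InnerProductSpace ℝ H]
    (S : ℝ → H →L[ℝ] H) : Prop where
  zero : S 0 = ContinuousLinearMap.id ℝ H
  add : ∀ s t, 0 ≤ s → 0 ≤ t → S (s + t) = (S s).comp (S t)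
  continuous : ∀ u, ContinuousOn (fun t => S t u) (Ici 0)
  contraction : ∀ t, 0 ≤ t → ‖S t‖ ≤ 1

/-- The (possibly unbounded) operator with graph `{(u, f) | R u f}` is the infinitesimal generator
of `S`: `u` lies in its domain with value `f` exactly when `(S t u - u) / t → f` as `t → 0+`. -/
def IsGenerator {H : Type*} [NormedAddCommGroup H] [InnerProductSpace ℝ H]
    (R : H → H → Prop) (S : ℝ → H →L[ℝ] H) : Prop :=
  ∀ u f, R u f ↔ Tendsto (fun t : ℝ => t⁻¹ • (S t u - u)) (𝓝[>] 0) (𝓝 f)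

namespace DampedSystem

variable {J : ℕ} {N : Fin J → ℕ}
  {V H : Type*} [NormedAddCommGroup V] [InnerProductSpace ℝ V] [CompleteSpace V]
  [NormedAddCommGroup H] [InnerProductSpace ℝ H] [CompleteSpace H]
  {X : Fin J → Type*} [∀ j, MetricSpace (X j)] [∀ j, MeasurableSpace (X j)]
  [∀ j, OpensMeasurableSpace (X j)]

/-- The component `(I_U u) j`, as a function on `X j`. -/
def comp (P : DampedSystem N V H X) (u : V) (j : Fin J) : X j → EuclideanSpace ℝ (Fin (N j)) :=
  fun x => ((P.IU u j : P.U j) : Lp (EuclideanSpace ℝ (Fin (N j))) 2 (P.μ j)) x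

/-- The pairing `⟨B(t)u, v⟩`. -/
def damping (P : DampedSystem N V H X) (t : ℝ) (u v : V) : ℝ :=
  ∑ j, ∫ x, P.α j t x * ⟪P.g j (P.comp u j x), P.comp v j x⟫_ℝ ∂(P.μ j)

/-- `u ∈ D(𝒜_B(t))` and `𝒜_B(t) u = f`: that is, `u ∈ V` and `(A₁ + B(t)) u`, an element of the
dual of `V`, is the element `f` of `H`. -/
def opGraph (P : DampedSystem N V H X) (t : ℝ) (u f : H) : Prop :=
  ∃ v : V, P.ι v = u ∧ ∀ w : V, P.A₁ v w + P.damping t v w = ⟪f, P.ι w⟫_ℝ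

/-- The graph in `H` of the linear operator `A₁ - I_U`, where `I_U` is read as the operator
`⟨I_U v, w⟩ = (I_U v, I_U w)_U` from `V` to its dual. -/
def graphBackward (P : DampedSystem N V H X) (u f : H) : Prop :=
  ∃ v : V, P.ι v = u ∧ ∀ w : V, P.A₁ v w - ⟪P.IU v, P.IU w⟫_ℝ = ⟪f, P.ι w⟫_ℝ

/-- The graph in `H` of the linear operator `-A₁ - I_U`. -/
def graphForward (P : DampedSystem N V H X) (u f : H) : Prop :=
  ∃ v : V, P.ι v = u ∧ ∀ w : V, -P.A₁ v w - ⟪P.IU v, P.IU w⟫_ℝ = ⟪f, P.ι w⟫_ℝ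

/-- `A₁ - I_U` generates a semigroup of contractions, and `-A₁ - I_U` generates a semigroup of
contractions that is exponentially stable with constants `C` and `ω`. -/
def LinearlyStable (P : DampedSystem N V H X) (C ω : ℝ) : Prop :=
  (∃ S : ℝ → H →L[ℝ] H, IsContractionSemigroup S ∧ IsGenerator P.graphBackward S) ∧
  ∃ S : ℝ → H →L[ℝ] H, IsContractionSemigroup S ∧ IsGenerator P.graphForward S ∧
    ∀ t, 0 ≤ t → ∀ u, ‖S t u‖ ≤ C * Real.exp (-ω * t) * ‖u‖

/-- `x` is a solution on `[0, ∞)` of `x' + A₁ x + B(t) x = 0` with initial value `x 0`: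
`x ∈ C([0, ∞); H)`, `x t ∈ D(𝒜_B(t))` for all `t ≥ 0`, and outside a countable set the derivative
`x' = -𝒜_B(t) x` exists in `H` and is continuous. -/
def IsSolution (P : DampedSystem N V H X) (x : ℝ → H) : Prop :=
  ContinuousOn x (Ici 0) ∧
  ∃ f : ℝ → H, (∀ t, 0 ≤ t → P.opGraph t (x t) (f t)) ∧
    ∃ Z : Set ℝ, Z.Countable ∧ ∀ t ∈ Ici (0 : ℝ) \ Z,
      HasDerivWithinAt x (-f t) (Ici 0) t ∧ ContinuousWithinAt f (Ici 0 \ Z) t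

end DampedSystem

/-- The energy `𝓔(t) = ‖x(t)‖² / 2`. -/
def energy {H : Type*} [NormedAddCommGroup H] (x : ℝ → H) (t : ℝ) : ℝ := ‖x t‖ ^ 2 / 2

/-- `h(x) = c (x + G(x))`. -/
def hFun (c : ℝ) (G : ℝ → ℝ) (x : ℝ) : ℝ := c * (x + G x)

/-- `p = h⁻¹` on `[0, ∞)`. -/
def pFun (c : ℝ) (G : ℝ → ℝ) : ℝ → ℝ := Function.invFunOn (hFun c G) (Ici 0)

/-- `ψ(x) = ∫ s in x..E₀, 1 / p(s)` for `x > 0`. -/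
def psi (c : ℝ) (G : ℝ → ℝ) (E₀ x : ℝ) : ℝ := ∫ s in x..E₀, 1 / pFun c G s

/-- The inverse `ψ⁻¹` of `ψ` as a function on `(0, ∞)`. -/
def psiInv (c : ℝ) (G : ℝ → ℝ) (E₀ : ℝ) : ℝ → ℝ := Function.invFunOn (psi c G E₀) (Ioi 0)

end HyperbolicDamping

end

/-!
A solution `x` is compared on `[a, a + T]` with the orbit `S (· - a) (x a)` of the contraction
semigroup generated by `-A₁ - I_U`. The squared distance of the two grows at most at the rate of
`‖I_U x‖² + ‖g (I_U x)‖²`, which a supergradient of the concave function `G` bounds affinely by the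
dissipation of `x`. As `‖S T‖ < 1`, the energy at time `a` is then at most `h` of a multiple of the
energy lost during the period; equivalently, the loss is at least a multiple of `p (energy x a)`.
Hence `ψ (energy x ·)` grows by a fixed amount in each period of length `T`.
-/

namespace HyperbolicDamping

theorem le_of_frequently_le_off_countable {φ : ℝ → ℝ} {a b : ℝ} {Z : Set ℝ} (hab : a ≤ b)
    (hφ : ContinuousOn φ (Icc a b)) (hZ : Z.Countable)
    (hfreq : ∀ t ∈ Ico a b \ Z, ∃ᶠ s in 𝓝[>] t, φ s ≤ φ t) : φ b ≤ φ a := by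
  by_contra! hlt
  -- The image of `Z` is countable, so some intermediate value is not attained on `Z`.
  obtain ⟨y, hyZ, hay, hyb⟩ := ((hZ.image φ).dense_compl ℝ).exists_between hlt
  have hcompact : IsCompact (Icc a b ∩ φ ⁻¹' Iic y) :=
    isCompact_Icc.of_isClosed_subset (hφ.preimage_isClosed_of_isClosed isClosed_Icc isClosed_Iic)
      inter_subset_left
  obtain ⟨t, ⟨⟨hat, htb⟩, hty⟩, hmax⟩ :=
    hcompact.exists_isGreatest ⟨a, left_mem_Icc.2 hab, hay.le⟩
  have htb : t < b := htb.lt_of_ne (by rintro rfl; exact hyb.not_ge hty)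
  have hexceed : ∀ᶠ s in 𝓝[>] t, s ∈ Icc a b ∧ y < φ s := by
    filter_upwards [Ioc_mem_nhdsGT htb] with s hs
    have hsI : s ∈ Icc a b := ⟨hat.trans hs.1.le, hs.2⟩
    exact ⟨hsI, lt_of_not_ge fun hsy => hs.1.not_ge (hmax ⟨hsI, hsy⟩)⟩
  have hφt : φ t = y := by
    refine le_antisymm hty (ge_of_tendsto ?_ (hexceed.mono fun s hs => hs.2.le))
    exact (hφ t ⟨hat, htb.le⟩).mono_left (nhdsWithin_le_iff.2 (hexceed.mono fun s hs => hs.1))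
  obtain ⟨s, hst, -, hys⟩ :=
    ((hfreq t ⟨⟨hat, htb⟩, fun h => hyZ ⟨t, h, hφt⟩⟩).and_eventually hexceed).exists
  exact (hst.trans_eq hφt).not_gt hys

theorem le_of_hasDerivWithinAt_nonpos_off_countable {ρ ρ' : ℝ → ℝ} {a b : ℝ} {Z : Set ℝ}
    (hab : a ≤ b) (hρ : ContinuousOn ρ (Icc a b)) (hZ : Z.Countable)
    (hderiv : ∀ t ∈ Ico a b \ Z, HasDerivWithinAt ρ (ρ' t) (Ioi t) t)
    (hnonpos : ∀ t ∈ Ico a b \ Z, ρ' t ≤ 0) : ρ b ≤ ρ a := by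
  have htilt : ∀ ε > 0, ρ b - ε * b ≤ ρ a - ε * a := fun ε hε => by
    refine le_of_frequently_le_off_countable (φ := fun t => ρ t - ε * t) hab
      (hρ.sub (by fun_prop)) hZ fun t ht => ?_
    have hslope := (hasDerivWithinAt_iff_tendsto_slope' self_notMem_Ioi).1
      ((hderiv t ht).sub ((hasDerivWithinAt_id t _).const_mul ε))
    have hneg : ρ' t - ε * 1 < 0 := by linarith [hnonpos t ht]
    refine Eventually.frequently ?_
    filter_upwards [hslope.eventually (gt_mem_nhds hneg), self_mem_nhdsWithin] with s hs hts
    rw [slope_def_field, div_lt_iff₀ (sub_pos.2 hts), zero_mul] at hs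
    exact (sub_neg.1 hs).le
  refine le_of_forall_pos_le_add fun δ hδ => ?_
  have hε : δ / (b - a + 1) * (b - a) ≤ δ := by
    rw [div_mul_eq_mul_div, div_le_iff₀ (by linarith)]
    nlinarith
  linarith [htilt (δ / (b - a + 1)) (div_pos hδ (by linarith))]

theorem exists_supergradient {G : ℝ → ℝ} {I : Set ℝ} (hG : ConcaveOn ℝ I G)
    (hmono : MonotoneOn G I) {s₀ : ℝ} (hs₀ : s₀ ∈ interior I) :
    ∃ σ ≥ 0, ∀ s ∈ I, G s ≤ G s₀ + σ * (s - s₀) := by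
  have hright : ∀ s ∈ I, s₀ < s → G s - G s₀ ≤ -derivWithin (-G) (Ioi s₀) s₀ * (s - s₀) :=
    fun s hs h => by
      have hslope := hG.neg.rightDeriv_le_slope_of_mem_interior hs₀ hs h
      rw [slope_def_field, le_div_iff₀ (sub_pos.2 h), Pi.neg_apply, Pi.neg_apply] at hslope
      linarith
  have hleft : ∀ s ∈ I, s < s₀ → G s - G s₀ ≤ -derivWithin (-G) (Ioi s₀) s₀ * (s - s₀) :=
    fun s hs h => by
      have hslope := (hG.neg.slope_le_leftDeriv_of_mem_interior hs hs₀ h).trans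
        (hG.neg.leftDeriv_le_rightDeriv_of_mem_interior hs₀)
      rw [slope_def_field, div_le_iff₀ (sub_pos.2 h), Pi.neg_apply, Pi.neg_apply] at hslope
      linarith
  refine ⟨-derivWithin (-G) (Ioi s₀) s₀, ?_, fun s hs => ?_⟩
  · obtain ⟨s, hs, hlt⟩ : (I ∩ Ioi s₀).Nonempty := nonempty_of_mem
      (inter_mem (nhdsWithin_le_nhds (mem_interior_iff_mem_nhds.1 hs₀)) self_mem_nhdsWithin)
    have hG_le := hmono (interior_subset hs₀) hs (le_of_lt hlt)
    exact nonneg_of_mul_nonneg_left ((sub_nonneg.2 hG_le).trans (hright s hs hlt)) (sub_pos.2 hlt)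
  · rcases lt_trichotomy s s₀ with h | rfl | h
    · linarith [hleft s hs h]
    · simp
    · linarith [hright s hs h]

theorem hasDerivWithinAt_Ioi_comp_add_const {E : Type*} [NormedAddCommGroup E] [NormedSpace ℝ E]
    {f : ℝ → E} {f' : E} {x c : ℝ} (hf : HasDerivWithinAt f f' (Ioi (x + c)) (x + c)) :
    HasDerivWithinAt (fun t => f (t + c)) f' (Ioi x) x := by
  have hshift : HasDerivWithinAt (fun t => t + c) 1 (Ioi x) x :=
    (hasDerivWithinAt_id x _).add_const c
  simpa only [one_smul, Function.comp_def] using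
    hf.scomp x hshift fun t ht => add_lt_add_left ht c

section InverseOfMonotone

variable {α β : Type*} [LinearOrder α] [Nonempty α] [Preorder β] {h : α → β} {s : Set α}
  {t : Set β}

theorem invFunOn_le_iff_of_strictMonoOn (hmono : StrictMonoOn h s) (hsurj : SurjOn h s t) {x : α}
    (hx : x ∈ s) {y : β} (hy : y ∈ t) : Function.invFunOn h s y ≤ x ↔ y ≤ h x := by
  rw [← hmono.le_iff_le (Function.invFunOn_mem (hsurj hy)) hx, Function.invFunOn_eq (hsurj hy)]

theorem le_invFunOn_iff_of_strictAntiOn (hanti : StrictAntiOn h s) (hsurj : SurjOn h s t) {x : α}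
    (hx : x ∈ s) {y : β} (hy : y ∈ t) : x ≤ Function.invFunOn h s y ↔ y ≤ h x := by
  rw [← hanti.le_iff_ge (Function.invFunOn_mem (hsurj hy)) hx, Function.invFunOn_eq (hsurj hy)]

theorem monotoneOn_invFunOn (hmono : StrictMonoOn h s) (hsurj : SurjOn h s t) :
    MonotoneOn (Function.invFunOn h s) t := fun _ hy _ hz hyz =>
  (invFunOn_le_iff_of_strictMonoOn hmono hsurj (Function.invFunOn_mem (hsurj hz)) hy).2
    (hyz.trans_eq (Function.invFunOn_eq (hsurj hz)).symm)

end InverseOfMonotone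

section Semigroup

variable {H : Type*} [NormedAddCommGroup H] [InnerProductSpace ℝ H] {S : ℝ → H →L[ℝ] H}

theorem IsGenerator.iff_hasDerivWithinAt {R : H → H → Prop} (hgen : IsGenerator R S)
    (hS : IsContractionSemigroup S) {u f : H} :
    R u f ↔ HasDerivWithinAt (fun t => S t u) f (Ioi 0) 0 := by
  rw [hgen u f, hasDerivWithinAt_iff_tendsto_slope' self_notMem_Ioi, slope_fun_def]
  simp only [hS.zero, sub_zero, ContinuousLinearMap.id_apply, vsub_eq_sub]

namespace IsContractionSemigroup

theorem map_add_apply (hS : IsContractionSemigroup S) {s t : ℝ} (hs : 0 ≤ s) (ht : 0 ≤ t) (u : H) :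
    S (s + t) u = S s (S t u) := by
  rw [hS.add s t hs ht, ContinuousLinearMap.comp_apply]

theorem hasDerivWithinAt_orbit_map (hS : IsContractionSemigroup S) {u f : H}
    (hu : HasDerivWithinAt (fun t => S t u) f (Ioi 0) 0) {s : ℝ} (hs : 0 ≤ s) :
    HasDerivWithinAt (fun t => S t (S s u)) (S s f) (Ioi 0) 0 := by
  have hcomm : ∀ t, 0 ≤ t → S t (S s u) = S s (S t u) := fun t ht => by
    rw [← hS.map_add_apply ht hs, add_comm, hS.map_add_apply hs ht]
  exact ((S s).hasFDerivAt.comp_hasDerivWithinAt 0 hu).congr (fun t ht => hcomm t (le_of_lt ht))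
    (hcomm 0 le_rfl)

theorem hasDerivWithinAt_orbit (hS : IsContractionSemigroup S) {u f : H}
    (hu : HasDerivWithinAt (fun t => S t u) f (Ioi 0) 0) {a t : ℝ} (hat : a ≤ t) :
    HasDerivWithinAt (fun r => S (r - a) u) (S (t - a) f) (Ioi t) t := by
  have horbit : HasDerivWithinAt (fun r => S (r + -t) u) f (Ioi t) t :=
    hasDerivWithinAt_Ioi_comp_add_const (f := fun r => S r u) (by rwa [add_neg_cancel])
  have hfactor : ∀ r, t ≤ r → S (r - a) u = S (t - a) (S (r + -t) u) := fun r hr => by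
    rw [← sub_eq_add_neg, ← hS.map_add_apply (sub_nonneg.2 hat) (sub_nonneg.2 hr),
      sub_add_sub_cancel']
  exact ((S (t - a)).hasFDerivAt.comp_hasDerivWithinAt t horbit).congr
    (fun r hr => hfactor r (le_of_lt hr)) (hfactor t le_rfl)

theorem intervalIntegrable_orbit (hS : IsContractionSemigroup S) (u : H) {a b : ℝ} (ha : 0 ≤ a)
    (hb : 0 ≤ b) : IntervalIntegrable (fun s => S s u) volume a b :=
  ((hS.continuous u).mono fun _ hs => (le_min ha hb).trans hs.1).intervalIntegrable

variable [CompleteSpace H]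

theorem map_integral_orbit (hS : IsContractionSemigroup S) (u : H) {t h : ℝ} (ht : 0 ≤ t)
    (hh : 0 ≤ h) : S t (∫ s in 0..h, S s u) = ∫ s in t..t + h, S s u := by
  calc S t (∫ s in 0..h, S s u) = ∫ s in 0..h, S t (S s u) :=
        ((S t).intervalIntegral_comp_comm (hS.intervalIntegrable_orbit u le_rfl hh)).symm
    _ = ∫ s in 0..h, S (t + s) u := intervalIntegral.integral_congr fun s hs => by
        rw [uIcc_of_le hh] at hs
        exact (hS.map_add_apply ht hs.1 u).symm
    _ = ∫ s in t..t + h, S s u := by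
        rw [intervalIntegral.integral_comp_add_left (fun s => S s u), add_zero]

theorem hasDerivWithinAt_integral_orbit (hS : IsContractionSemigroup S) (u : H) {h : ℝ}
    (hh : 0 ≤ h) : HasDerivWithinAt (fun t => ∫ s in 0..t, S s u) (S h u) (Ioi h) h := by
  have hcont : ContinuousOn (fun s => S s u) (Ioi h) :=
    (hS.continuous u).mono fun s hs => hh.trans (le_of_lt hs)
  exact (intervalIntegral.integral_hasDerivWithinAt_right
    (hS.intervalIntegrable_orbit u le_rfl hh) (s := Ici h) (t := Ioi h)
    ⟨Ioi h, self_mem_nhdsWithin, hcont.aestronglyMeasurable measurableSet_Ioi⟩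
    ((hS.continuous u h hh).mono fun s hs => hh.trans (le_of_lt hs))).mono Ioi_subset_Ici_self

theorem hasDerivWithinAt_orbit_integral_orbit (hS : IsContractionSemigroup S) (u : H) {h : ℝ}
    (hh : 0 ≤ h) :
    HasDerivWithinAt (fun t => S t (∫ s in 0..h, S s u)) (S h u - u) (Ioi 0) 0 := by
  have hshifted : HasDerivWithinAt (fun t => ∫ s in 0..t + h, S s u) (S h u) (Ioi 0) 0 :=
    hasDerivWithinAt_Ioi_comp_add_const (f := fun t => ∫ s in 0..t, S s u)
      (by simpa only [zero_add] using hS.hasDerivWithinAt_integral_orbit u hh)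
  have hstart : HasDerivWithinAt (fun t => ∫ s in 0..t, S s u) u (Ioi 0) 0 := by
    simpa only [hS.zero, ContinuousLinearMap.id_apply]
      using hS.hasDerivWithinAt_integral_orbit u le_rfl
  have hdiff : ∀ t, 0 ≤ t →
      S t (∫ s in 0..h, S s u) = (∫ s in 0..t + h, S s u) - ∫ s in 0..t, S s u := fun t ht => by
    rw [hS.map_integral_orbit u ht hh, intervalIntegral.integral_interval_sub_left
      (hS.intervalIntegrable_orbit u le_rfl (add_nonneg ht hh))
      (hS.intervalIntegrable_orbit u le_rfl ht)]
  exact (hshifted.sub hstart).congr (fun t ht => hdiff t (le_of_lt ht)) (hdiff 0 le_rfl)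

theorem dense_generator_domain (hS : IsContractionSemigroup S) :
    Dense {u | ∃ f, HasDerivWithinAt (fun t => S t u) f (Ioi 0) 0} := by
  intro u
  have haverage : Tendsto (fun h : ℝ => h⁻¹ • ∫ s in 0..h, S s u) (𝓝[>] 0) (𝓝 u) := by
    simpa [hasDerivWithinAt_iff_tendsto_slope' self_notMem_Ioi, slope_fun_def, hS.zero]
      using hS.hasDerivWithinAt_integral_orbit u le_rfl
  refine mem_closure_of_tendsto haverage ?_
  filter_upwards [self_mem_nhdsWithin] with h hh
  refine ⟨h⁻¹ • (S h u - u), ?_⟩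
  simpa only [map_smul, Pi.smul_def] using
    (hS.hasDerivWithinAt_orbit_integral_orbit u (le_of_lt hh)).const_smul h⁻¹

end IsContractionSemigroup

end Semigroup

section AntitoneIntegrand

variable {q : ℝ → ℝ} (hq : AntitoneOn q (Ioi 0))
include hq

theorem intervalIntegrable_of_antitoneOn_Ioi {x y : ℝ} (hx : 0 < x) (hy : 0 < y) :
    IntervalIntegrable q volume x y :=
  (hq.mono fun _ hs => (lt_min hx hy).trans_le hs.1).intervalIntegrable

theorem sub_mul_le_integral {x y : ℝ} (hx : 0 < x) (hxy : x ≤ y) :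
    (y - x) * q y ≤ ∫ s in x..y, q s := by
  calc (y - x) * q y = ∫ _ in x..y, q y := by rw [intervalIntegral.integral_const, smul_eq_mul]
    _ ≤ ∫ s in x..y, q s :=
        intervalIntegral.integral_mono_on hxy intervalIntegrable_const
          (intervalIntegrable_of_antitoneOn_Ioi hq hx (hx.trans_le hxy))
          fun s hs => hq (hx.trans_le hs.1) (hx.trans_le hxy) hs.2

theorem strictAntiOn_integral_lower (hpos : ∀ s > 0, 0 < q s) {b : ℝ} (hb : 0 < b) :
    StrictAntiOn (fun x => ∫ s in x..b, q s) (Ioi 0) := by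
  intro x hx y hy hxy
  have hpiece : 0 < ∫ s in x..y, q s :=
    (mul_pos (sub_pos.2 hxy) (hpos y hy)).trans_le (sub_mul_le_integral hq hx hxy.le)
  have hsplit := intervalIntegral.integral_add_adjacent_intervals
    (intervalIntegrable_of_antitoneOn_Ioi hq hx hy) (intervalIntegrable_of_antitoneOn_Ioi hq hy hb)
  simp only
  linarith

theorem surjOn_integral_lower {c : ℝ} (hc : 0 < c) (hcq : ∀ s > 0, c / s ≤ q s) {b : ℝ}
    (hb : 0 < b) : SurjOn (fun x => ∫ s in x..b, q s) (Ioi 0) (Ici 0) := by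
  intro z hz
  obtain ⟨x, hx, hxb, hlog⟩ : ∃ x, 0 < x ∧ x ≤ b ∧ c * Real.log (b / x) = z := by
    refine ⟨b * Real.exp (-(z / c)), by positivity, mul_le_of_le_one_right hb.le
      (Real.exp_le_one_iff.2 (neg_nonpos.2 (div_nonneg hz hc.le))), ?_⟩
    rw [← div_div, div_self hb.ne', one_div, Real.log_inv, Real.log_exp, neg_neg,
      mul_div_cancel₀ z hc.ne']
  have hint := intervalIntegrable_of_antitoneOn_Ioi hq hx hb
  have hlarge : z ≤ ∫ s in x..b, q s := by
    rw [← hlog, ← integral_one_div_of_pos hx hb, ← intervalIntegral.integral_const_mul]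
    refine intervalIntegral.integral_mono_on hxb
      ((intervalIntegral.intervalIntegrable_one_div
        (fun s hs => ((lt_min hx hb).trans_le hs.1).ne') continuousOn_id).const_mul c) hint
      fun s hs => ?_
    simpa only [mul_one_div] using hcq s (hx.trans_le hs.1)
  have hcont : ContinuousOn (fun y => ∫ s in y..b, q s) (Icc x b) := by
    have hprimitive := (intervalIntegral.continuousOn_primitive_interval' hint right_mem_uIcc).neg
    rw [uIcc_of_le hxb] at hprimitive
    exact hprimitive.congr fun y _ => intervalIntegral.integral_symm b y
  obtain ⟨y, hy, hyz⟩ := intermediate_value_Icc' hxb hcont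
    ⟨intervalIntegral.integral_same.trans_le hz, hlarge⟩
  exact ⟨y, hx.trans_le hy.1, hyz⟩

theorem nat_mul_le_integral_of_loss {e : ℕ → ℝ} (he : Antitone e) {κ : ℝ}
    (hloss : ∀ n, 0 < e (n + 1) → κ ≤ (e n - e (n + 1)) * q (e n)) (n : ℕ) (hn : 0 < e n) :
    n * κ ≤ ∫ s in e n..e 0, q s := by
  induction n with
  | zero => simp
  | succ n ih =>
    have hle : e (n + 1) ≤ e n := he n.le_succ
    have hpos : 0 < e n := hn.trans_le hle
    have hlast := (hloss n hn).trans (sub_mul_le_integral hq hn hle)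
    have hsplit := intervalIntegral.integral_add_adjacent_intervals
      (intervalIntegrable_of_antitoneOn_Ioi hq hn hpos)
      (intervalIntegrable_of_antitoneOn_Ioi hq hpos (hpos.trans_le (he n.zero_le)))
    push_cast
    linarith [ih hpos]

theorem mul_sub_le_integral_of_periodic_loss {E : ℝ → ℝ} (hE : AntitoneOn E (Ici 0)) {T κ : ℝ}
    (hT : 0 < T) (hκ : 0 ≤ κ) (hpos : ∀ s > 0, 0 < q s)
    (hloss : ∀ a ≥ 0, 0 < E (a + T) → κ ≤ (E a - E (a + T)) * q (E a)) {t : ℝ} (ht : 0 ≤ t)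
    (hEt : 0 < E t) : κ / T * (t - T) ≤ ∫ s in E t..E 0, q s := by
  have hmem : ∀ n : ℕ, (n : ℝ) * T ∈ Ici (0 : ℝ) := fun n => by
    rw [mem_Ici]; positivity
  have hstep : ∀ n : ℕ, ((n + 1 : ℕ) : ℝ) * T = n * T + T := fun n => by push_cast; ring
  have hanti : Antitone fun n : ℕ => E (n * T) := fun k n hkn =>
    hE (hmem k) (hmem n) (by gcongr)
  set n := ⌊t / T⌋₊
  have hnt : n * T ≤ t := (le_div_iff₀ hT).1 (Nat.floor_le (by positivity))
  have hle : E t ≤ E (n * T) := hE (hmem n) ht hnt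
  have hEn : 0 < E (n * T) := hEt.trans_le hle
  have hn := nat_mul_le_integral_of_loss hq hanti (κ := κ) (fun k hk => by
    rw [hstep] at hk ⊢
    exact hloss (k * T) (hmem k) hk) n hEn
  simp only [Nat.cast_zero, zero_mul] at hn
  have hE₀ : 0 < E 0 := hEt.trans_le (hE self_mem_Ici ht ht)
  calc κ / T * (t - T) = (t / T - 1) * κ := by field_simp
    _ ≤ n * κ := by gcongr; linarith [Nat.lt_floor_add_one (t / T)]
    _ ≤ ∫ s in E (n * T)..E 0, q s := hn
    _ ≤ ∫ s in E t..E 0, q s := (strictAntiOn_integral_lower hq hpos hE₀).antitoneOn hEt hEn hle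

end AntitoneIntegrand

section DecayProfile

variable {c : ℝ} {G : ℝ → ℝ}

theorem strictMonoOn_hFun (hc : 0 < c) (hG : MonotoneOn G (Ici 0)) :
    StrictMonoOn (hFun c G) (Ici 0) := fun _ hx _ hy hxy =>
  mul_lt_mul_of_pos_left (add_lt_add_of_lt_of_le hxy (hG hx hy hxy.le)) hc

variable (hc : 0 < c) (hG : MonotoneOn G (Ici 0)) (hG₀ : G 0 = 0) (hcont : ContinuousOn G (Ici 0))
include hc hG hG₀

theorem mul_le_hFun {x : ℝ} (hx : 0 ≤ x) : c * x ≤ hFun c G x :=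
  mul_le_mul_of_nonneg_left (le_add_of_nonneg_right (hG₀ ▸ hG self_mem_Ici hx hx)) hc.le

include hcont

theorem bijOn_hFun : BijOn (hFun c G) (Ici 0) (Ici 0) := by
  refine ⟨fun x hx => (mul_nonneg hc.le hx).trans (mul_le_hFun hc hG hG₀ hx),
    (strictMonoOn_hFun hc hG).injOn, fun y hy => ?_⟩
  have hyc : 0 ≤ y / c := div_nonneg hy hc.le
  have hcontinuous : ContinuousOn (hFun c G) (Icc 0 (y / c)) :=
    (continuousOn_const.mul (continuousOn_id.add hcont)).mono Icc_subset_Ici_self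
  have hzero : hFun c G 0 = 0 := by rw [hFun, hG₀, add_zero, mul_zero]
  have hlarge : y ≤ hFun c G (y / c) := by
    simpa only [mul_div_cancel₀ y hc.ne'] using mul_le_hFun hc hG hG₀ hyc
  obtain ⟨x, hx, hxy⟩ := intermediate_value_Icc hyc hcontinuous ⟨hzero.trans_le hy, hlarge⟩
  exact ⟨x, hx.1, hxy⟩

theorem pFun_le_iff {x y : ℝ} (hx : 0 ≤ x) (hy : 0 ≤ y) : pFun c G y ≤ x ↔ y ≤ hFun c G x :=
  invFunOn_le_iff_of_strictMonoOn (strictMonoOn_hFun hc hG) (bijOn_hFun hc hG hG₀ hcont).surjOn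
    hx hy

theorem pFun_pos {y : ℝ} (hy : 0 < y) : 0 < pFun c G y := by
  refine lt_of_not_ge fun h => hy.not_ge ?_
  simpa only [hFun, hG₀, add_zero, mul_zero]
    using (pFun_le_iff hc hG hG₀ hcont le_rfl hy.le).1 h

theorem pFun_le_div {y : ℝ} (hy : 0 ≤ y) : pFun c G y ≤ y / c := by
  have hyc : 0 ≤ y / c := div_nonneg hy hc.le
  refine (pFun_le_iff hc hG hG₀ hcont hyc hy).2 ?_
  simpa only [mul_div_cancel₀ y hc.ne'] using mul_le_hFun hc hG hG₀ hyc

theorem antitoneOn_one_div_pFun : AntitoneOn (fun s => 1 / pFun c G s) (Ioi 0) :=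
  fun _ hx _ hy hxy => one_div_le_one_div_of_le (pFun_pos hc hG hG₀ hcont hx)
    (monotoneOn_invFunOn (strictMonoOn_hFun hc hG) (bijOn_hFun hc hG hG₀ hcont).surjOn
      (Ioi_subset_Ici_self hx) (Ioi_subset_Ici_self hy) hxy)

variable {E₀ : ℝ} (hE₀ : 0 < E₀)
include hE₀

theorem strictAntiOn_psi : StrictAntiOn (psi c G E₀) (Ioi 0) :=
  strictAntiOn_integral_lower (antitoneOn_one_div_pFun hc hG hG₀ hcont)
    (fun _ hs => one_div_pos.2 (pFun_pos hc hG hG₀ hcont hs)) hE₀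

theorem surjOn_psi : SurjOn (psi c G E₀) (Ioi 0) (Ici 0) :=
  surjOn_integral_lower (antitoneOn_one_div_pFun hc hG hG₀ hcont) hc (fun s hs => by
    simpa only [one_div_div] using one_div_le_one_div_of_le (pFun_pos hc hG hG₀ hcont hs)
      (pFun_le_div hc hG hG₀ hcont (le_of_lt hs))) hE₀

theorem le_psiInv {e z : ℝ} (hz : 0 ≤ z) (h : 0 < e → z ≤ psi c G E₀ e) :
    e ≤ psiInv c G E₀ z := by
  have hsurj := surjOn_psi hc hG hG₀ hcont hE₀
  rcases le_or_gt e 0 with he | he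
  · exact he.trans (le_of_lt (Function.invFunOn_mem (hsurj hz)))
  · exact (le_invFunOn_iff_of_strictAntiOn (strictAntiOn_psi hc hG hG₀ hcont hE₀) hsurj he hz).2
      (h he)

omit hE₀

theorem le_psiInv_of_periodic_loss {E : ℝ → ℝ} (hE : AntitoneOn E (Ici 0)) (hE₀ : 0 < E 0)
    {T κ : ℝ} (hT : 0 < T) (hκ : 0 ≤ κ)
    (hloss : ∀ a ≥ 0, 0 < E a → κ * pFun c G (E a) ≤ E a - E (a + T)) {t : ℝ} (ht : T ≤ t) :
    E t ≤ psiInv c G (E 0) (κ / T * (t - T)) := by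
  refine le_psiInv hc hG hG₀ hcont hE₀
    (mul_nonneg (div_nonneg hκ hT.le) (sub_nonneg.2 ht)) fun hEt => ?_
  refine mul_sub_le_integral_of_periodic_loss (antitoneOn_one_div_pFun hc hG hG₀ hcont) hE hT hκ
    (fun s hs => one_div_pos.2 (pFun_pos hc hG hG₀ hcont hs)) (fun a ha hpos => ?_)
    (hT.le.trans ht) hEt
  have hEa : 0 < E a :=
    hpos.trans_le (hE ha (add_nonneg ha hT.le) (le_add_of_nonneg_right hT.le))
  rw [mul_one_div, le_div_iff₀ (pFun_pos hc hG hG₀ hcont hEa)]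
  exact hloss a ha hEa

end DecayProfile

section Comparison

variable {E : Type*} [NormedAddCommGroup E] [NormedSpace ℝ E]

/-- The notion of derivative shared by all the differential inequalities below: on `[a, ∞)` the
curve `x` is continuous and, outside a countable set of times, has the right derivative `x'`. -/
def HasRightDerivOffCountable (x x' : ℝ → E) (a : ℝ) : Prop :=
  ContinuousOn x (Ici a) ∧
    ∃ Z : Set ℝ, Z.Countable ∧ ∀ t ∈ Ici a \ Z, HasDerivWithinAt x (x' t) (Ioi t) t

theorem HasRightDerivOffCountable.antitoneOn {φ φ' : ℝ → ℝ} {a : ℝ}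
    (hφ : HasRightDerivOffCountable φ φ' a) (hφ' : ∀ t ≥ a, φ' t ≤ 0) : AntitoneOn φ (Ici a) := by
  obtain ⟨hcont, Z, hZ, hderiv⟩ := hφ
  intro r hr s _ hrs
  exact le_of_hasDerivWithinAt_nonpos_off_countable hrs
    (hcont.mono fun t ht => le_trans hr ht.1) hZ
    (fun t ht => hderiv t ⟨le_trans hr ht.1.1, ht.2⟩) fun t ht => hφ' t (le_trans hr ht.1.1)

variable {H : Type*} [NormedAddCommGroup H]

theorem energy_nonneg (x : ℝ → H) (t : ℝ) : 0 ≤ energy x t := by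
  rw [energy]; positivity

theorem continuousOn_energy {x : ℝ → H} {s : Set ℝ} (hx : ContinuousOn x s) :
    ContinuousOn (energy x) s := (hx.norm.pow 2).div_const 2

variable [InnerProductSpace ℝ H]

theorem hasDerivWithinAt_energy {x : ℝ → H} {x' : H} {t : ℝ} {s : Set ℝ}
    (hx : HasDerivWithinAt x x' s t) : HasDerivWithinAt (energy x) ⟪x t, x'⟫_ℝ s t := by
  have hsq := hx.norm_sq.div_const 2
  rwa [mul_div_cancel_left₀ _ two_ne_zero] at hsq

variable {x f : ℝ → H} (hx : HasRightDerivOffCountable x (-f) 0)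
include hx

theorem antitoneOn_energy (hf : ∀ t ≥ 0, 0 ≤ ⟪f t, x t⟫_ℝ) : AntitoneOn (energy x) (Ici 0) := by
  obtain ⟨hcont, Z, hZ, hderiv⟩ := hx
  refine HasRightDerivOffCountable.antitoneOn (φ' := fun t => ⟪x t, -f t⟫_ℝ)
    ⟨continuousOn_energy hcont, Z, hZ, fun t ht => hasDerivWithinAt_energy (hderiv t ht)⟩
    fun t ht => ?_
  rw [inner_neg_right, real_inner_comm, neg_nonpos]
  exact hf t ht

variable {S : ℝ → H →L[ℝ] H} (hS : IsContractionSemigroup S) {A B : ℝ}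
  (hsource : ∀ t ≥ 0, ∀ z z', HasDerivWithinAt (fun r => S r z) z' (Ioi 0) 0 →
    ⟪-f t - z', x t - z⟫_ℝ ≤ A + B * ⟪f t, x t⟫_ℝ)
  {a T : ℝ} (ha : 0 ≤ a) (hT : 0 ≤ T)
include hS hsource ha hT

theorem norm_sub_orbit_sq_le_of_mem_domain {y y' : H}
    (hy : HasDerivWithinAt (fun r => S r y) y' (Ioi 0) 0) :
    ‖x (a + T) - S T y‖ ^ 2 / 2 ≤
      ‖x a - y‖ ^ 2 / 2 + B * (energy x a - energy x (a + T)) + A * T := by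
  obtain ⟨hcont, Z, hZ, hderiv⟩ := hx
  set d : ℝ → H := fun t => x t - S (t - a) y with hd
  have hxcont : ContinuousOn x (Ici a) := hcont.mono (Ici_subset_Ici.2 ha)
  have hdcont : ContinuousOn d (Ici a) :=
    hxcont.sub ((hS.continuous y).comp (f := fun t => t - a) (by fun_prop)
      fun t ht => mem_Ici.2 (sub_nonneg.2 (mem_Ici.1 ht)))
  have hlyapunov : HasRightDerivOffCountable (fun t => energy d t + B * energy x t - A * t)
      (fun t => ⟪d t, -f t - S (t - a) y'⟫_ℝ + B * ⟪x t, -f t⟫_ℝ - A * 1) a := by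
    refine ⟨((continuousOn_energy hdcont).add
      (continuousOn_const.mul (continuousOn_energy hxcont))).sub (by fun_prop), Z, hZ, ?_⟩
    rintro t ⟨hat, htZ⟩
    have hxt := hderiv t ⟨ha.trans hat, htZ⟩
    exact ((hasDerivWithinAt_energy (hxt.sub (hS.hasDerivWithinAt_orbit hy hat))).add
      ((hasDerivWithinAt_energy hxt).const_mul B)).sub ((hasDerivWithinAt_id t _).const_mul A)
  have hdecay := hlyapunov.antitoneOn (fun t ht => by
    have := hsource t (ha.trans ht) _ _ (hS.hasDerivWithinAt_orbit_map hy (sub_nonneg.2 ht))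
    rw [real_inner_comm, inner_neg_right, real_inner_comm (f t)]
    linarith) self_mem_Ici (le_add_of_nonneg_right hT) (le_add_of_nonneg_right hT)
  simp only [energy, hd, add_sub_cancel_left, sub_self, hS.zero,
    ContinuousLinearMap.id_apply] at hdecay ⊢
  linarith

variable [CompleteSpace H]

theorem norm_sub_orbit_sq_le :
    ‖x (a + T) - S T (x a)‖ ^ 2 / 2 ≤ B * (energy x a - energy x (a + T)) + A * T := by
  obtain ⟨y, hy, hlim⟩ := mem_closure_iff_seq_limit.1 (hS.dense_generator_domain (x a))
  have hleft : Tendsto (fun n => ‖x (a + T) - S T (y n)‖ ^ 2 / 2) atTop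
      (𝓝 (‖x (a + T) - S T (x a)‖ ^ 2 / 2)) :=
    ((tendsto_const_nhds.sub (((S T).continuous.tendsto _).comp hlim)).norm.pow 2).div_const 2
  have hright : Tendsto (fun n => ‖x a - y n‖ ^ 2 / 2 +
      B * (energy x a - energy x (a + T)) + A * T) atTop
      (𝓝 (‖x a - x a‖ ^ 2 / 2 + B * (energy x a - energy x (a + T)) + A * T)) :=
    ((((tendsto_const_nhds.sub hlim).norm.pow 2).div_const 2).add_const _).add_const _
  have hle := le_of_tendsto_of_tendsto' hleft hright fun n =>
    norm_sub_orbit_sq_le_of_mem_domain hx hS hsource ha hT (hy n).choose_spec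
  simpa using hle

theorem energy_le_of_norm_lt_one {q : ℝ} (hST : ‖S T‖ ≤ q) (hq : q < 1) :
    energy x a ≤ (energy x a - energy x (a + T)) / (1 - q) +
      (B * (energy x a - energy x (a + T)) + A * T) / (1 - q) ^ 2 := by
  have hp : 0 < 1 - q := sub_pos.2 hq
  have hq₀ : 0 ≤ q := (norm_nonneg _).trans hST
  set d := ‖x (a + T) - S T (x a)‖
  have hdist : d ^ 2 / 2 ≤ B * (energy x a - energy x (a + T)) + A * T :=
    norm_sub_orbit_sq_le hx hS hsource ha hT
  have hnorm : ‖x (a + T)‖ ≤ q * ‖x a‖ + (1 - q) * (d / (1 - q)) := by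
    rw [mul_div_cancel₀ d hp.ne']
    linarith [norm_le_norm_add_norm_sub' (x (a + T)) (S T (x a)), (S T).le_of_opNorm_le hST (x a)]
  have hconvex : (q * ‖x a‖ + (1 - q) * (d / (1 - q))) ^ 2 ≤
      q * ‖x a‖ ^ 2 + (1 - q) * (d / (1 - q)) ^ 2 :=
    (convexOn_pow 2).2 (norm_nonneg (x a)) (div_nonneg (norm_nonneg _) hp.le) hq₀ hp.le
      (add_sub_cancel _ _)
  have hstep : energy x (a + T) ≤ q * energy x a + d ^ 2 / 2 / (1 - q) := by
    calc energy x (a + T) ≤ (q * ‖x a‖ ^ 2 + (1 - q) * (d / (1 - q)) ^ 2) / 2 :=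
          div_le_div_of_nonneg_right ((pow_le_pow_left₀ (norm_nonneg _) hnorm 2).trans hconvex)
            zero_le_two
      _ = q * energy x a + d ^ 2 / 2 / (1 - q) := by rw [energy]; field_simp
  calc energy x a
      ≤ (energy x a - energy x (a + T) + d ^ 2 / 2 / (1 - q)) / (1 - q) := by
        rw [le_div_iff₀ hp]; linarith
    _ = (energy x a - energy x (a + T)) / (1 - q) + d ^ 2 / 2 / (1 - q) ^ 2 := by
        rw [add_div, div_div _ (1 - q) (1 - q), ← sq (1 - q)]
    _ ≤ _ := by gcongr

end Comparison

section Decay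

/-- The constant `c` of the decay profile `h = c (id + G)`, for a semigroup with `‖S T‖ ≤ q`, for
energy losses over a period `T` measured in units of `κ`, and for a source bounded by
`A β + B (σ + K) ⟪f, x⟫` whenever `G s ≤ β + σ s`. -/
noncomputable def decayConst (κ q T A B K : ℝ) : ℝ :=
  κ / (1 - q) + ((1 + K) * B * κ + A * T) / (1 - q) ^ 2

theorem decayConst_pos {κ q T A B K : ℝ} (hκ : 0 < κ) (hq : q < 1) (hT : 0 ≤ T) (hA : 0 ≤ A)
    (hB : 0 ≤ B) (hK : 0 ≤ K) : 0 < decayConst κ q T A B K := by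
  have : 0 < 1 - q := sub_pos.2 hq
  unfold decayConst
  positivity

variable {H : Type*} [NormedAddCommGroup H] [InnerProductSpace ℝ H] [CompleteSpace H]
  {x f : ℝ → H} (hx : HasRightDerivOffCountable x (-f) 0)
  {S : ℝ → H →L[ℝ] H} (hS : IsContractionSemigroup S)
  {T q : ℝ} (hST : ‖S T‖ ≤ q) (hq : q < 1)
  {G : ℝ → ℝ} (hG : ConcaveOn ℝ (Ici 0) G) (hmono : MonotoneOn G (Ici 0)) (hG₀ : G 0 = 0)
  {A B K : ℝ} (hA : 0 ≤ A) (hB : 0 ≤ B) (hK : 0 ≤ K)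
  (hsource : ∀ t ≥ 0, ∀ z z', HasDerivWithinAt (fun r => S r z) z' (Ioi 0) 0 →
    ∀ β σ, 0 ≤ β → 0 ≤ σ → (∀ s ≥ 0, G s ≤ β + σ * s) →
      ⟪-f t - z', x t - z⟫_ℝ ≤ A * β + B * (σ + K) * ⟪f t, x t⟫_ℝ)
  {κ : ℝ}
include hx hS hST hq hG hmono hG₀ hA hB hK hsource

/- A supergradient of `G` gives an affine bound, so that the nonlinear growth condition can be
integrated; taken at `s` itself, its offset and slope stay controlled by `G s`. -/
theorem energy_le_hFun_of_loss_le (hT : 0 ≤ T) (hκ : 0 ≤ κ) {a s : ℝ} (ha : 0 ≤ a) (hs : 0 < s)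
    (hloss : energy x a - energy x (a + T) ≤ κ * s) :
    energy x a ≤ hFun (decayConst κ q T A B K) G s := by
  have : 0 < 1 - q := sub_pos.2 hq
  obtain ⟨σ, hσ, hσG⟩ := exists_supergradient hG hmono (s₀ := s) (by rwa [interior_Ici])
  have hβ : 0 ≤ G s - σ * s := by linarith [hσG 0 self_mem_Ici]
  have hσs : 0 ≤ σ * s := mul_nonneg hσ hs.le
  calc energy x a
      ≤ (energy x a - energy x (a + T)) / (1 - q) +
          (B * (σ + K) * (energy x a - energy x (a + T)) + A * (G s - σ * s) * T) / (1 - q) ^ 2 :=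
        energy_le_of_norm_lt_one hx hS (fun t ht z z' hz => hsource t ht z z' hz _ σ hβ hσ
          fun r hr => (hσG r hr).trans_eq (by ring)) ha hT hST hq
    _ ≤ κ * s / (1 - q) + (B * (σ + K) * (κ * s) + A * (G s - σ * s) * T) / (1 - q) ^ 2 := by
        gcongr
    _ = κ / (1 - q) * s + (B * κ * (σ * s + K * s) + A * T * (G s - σ * s)) / (1 - q) ^ 2 := by
        ring
    _ ≤ κ / (1 - q) * (s + G s) +
          (B * κ * (s + G s + K * (s + G s)) + A * T * (s + G s)) / (1 - q) ^ 2 := by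
        gcongr <;> linarith
    _ = hFun (decayConst κ q T A B K) G s := by rw [hFun, decayConst]; ring

theorem energy_le_psiInv (hf : ∀ t ≥ 0, 0 ≤ ⟪f t, x t⟫_ℝ) (hT : 0 < T) (hκ : 0 < κ)
    (hcont : ContinuousOn G (Ici 0)) (hE₀ : 0 < energy x 0) {ν : ℝ} (hν : 0 ≤ ν) (hνκ : ν ≤ κ)
    {t : ℝ} (ht : T ≤ t) :
    energy x t ≤ psiInv (decayConst κ q T A B K) G (energy x 0) (ν / T * (t - T)) := by
  have hc := decayConst_pos hκ hq hT.le hA hB hK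
  have hanti := antitoneOn_energy hx hf
  refine le_psiInv_of_periodic_loss hc hmono hG₀ hcont hanti hE₀ hT hν (fun a ha hEa => ?_) ht
  have hloss : 0 ≤ energy x a - energy x (a + T) := sub_nonneg.2 (hanti ha
    (add_nonneg ha hT.le) (le_add_of_nonneg_right hT.le))
  have hp : pFun (decayConst κ q T A B K) G (energy x a) ≤
      (energy x a - energy x (a + T)) / κ := le_of_forall_gt_imp_ge_of_dense fun s hs => by
    have hs₀ : 0 < s := (div_nonneg hloss hκ.le).trans_lt hs
    exact (pFun_le_iff hc hmono hG₀ hcont hs₀.le hEa.le).2 (energy_le_hFun_of_loss_le hx hS hST hq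
      hG hmono hG₀ hA hB hK hsource hT.le hκ.le ha hs₀ ((div_lt_iff₀' hκ).1 hs).le)
  calc ν * pFun (decayConst κ q T A B K) G (energy x a)
      ≤ κ * pFun (decayConst κ q T A B K) G (energy x a) :=
        mul_le_mul_of_nonneg_right hνκ (pFun_pos hc hmono hG₀ hcont hEa).le
    _ ≤ energy x a - energy x (a + T) := (le_div_iff₀' hκ).1 hp

end Decay

theorem memLp_comp_of_linear_growth {Y E F : Type*} [MeasurableSpace Y] {ν : Measure Y}
    [IsFiniteMeasure ν] [NormedAddCommGroup E] [NormedAddCommGroup F] {p : ENNReal} {f : Y → E}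
    (hf : MemLp f p ν) {g : E → F} (hg : Continuous g) {M : ℝ}
    (hM : ∀ y, ‖g y‖ ≤ M * (1 + ‖y‖)) : MemLp (fun x => g (f x)) p ν := by
  refine ((memLp_const (1 : ℝ)).add hf.norm).of_le_mul (c := M)
    (hg.comp_aestronglyMeasurable hf.1) (ae_of_all _ fun x => ?_)
  rw [Pi.add_apply, Real.norm_of_nonneg (add_nonneg zero_le_one (norm_nonneg (f x)))]
  exact hM (f x)

section Pointwise

variable {E : Type*} [NormedAddCommGroup E] [InnerProductSpace ℝ E]

theorem integrable_inner_of_memLp {Y : Type*} [MeasurableSpace Y] {ν : Measure Y} {f g : Y → E}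
    (hf : MemLp f 2 ν) (hg : MemLp g 2 ν) : Integrable (fun x => ⟪f x, g x⟫_ℝ) ν := by
  refine (L2.integrable_inner (𝕜 := ℝ) (hf.toLp f) (hg.toLp g)).congr ?_
  filter_upwards [hf.coeFn_toLp, hg.coeFn_toLp] with x hfx hgx
  rw [hfx, hgx]

theorem neg_mul_inner_add_inner_sub_inner_le (y z γ : E) {a b : ℝ} (ha : 0 ≤ a) (hab : a ≤ b) :
    -(a * ⟪γ, z⟫_ℝ) + ⟪y, z⟫_ℝ - ⟪z, z⟫_ℝ ≤ (1 + b ^ 2) / 4 * (‖y‖ ^ 2 + ‖γ‖ ^ 2) := by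
  set w := y - a • γ
  have hsquare : ⟪w, z⟫_ℝ - ⟪z, z⟫_ℝ ≤ ‖w‖ ^ 2 / 4 := by
    rw [real_inner_self_eq_norm_sq]
    linarith [real_inner_le_norm w z, sq_nonneg (‖w‖ / 2 - ‖z‖)]
  have hnorm : ‖w‖ ≤ ‖y‖ + b * ‖γ‖ := by
    refine (norm_sub_le _ _).trans (add_le_add_right ?_ _)
    rw [norm_smul, Real.norm_of_nonneg ha]
    gcongr
  calc -(a * ⟪γ, z⟫_ℝ) + ⟪y, z⟫_ℝ - ⟪z, z⟫_ℝ = ⟪w, z⟫_ℝ - ⟪z, z⟫_ℝ := by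
        rw [inner_sub_left, real_inner_smul_left]; ring
    _ ≤ (‖y‖ + b * ‖γ‖) ^ 2 / 4 := hsquare.trans (by gcongr)
    _ ≤ (1 + b ^ 2) / 4 * (‖y‖ ^ 2 + ‖γ‖ ^ 2) := by linarith [sq_nonneg (b * ‖y‖ - ‖γ‖)]

theorem norm_sq_add_norm_sq_le_of_growth {y γ : E} {M m β σ : ℝ} {G : ℝ → ℝ} (hm : 0 < m)
    (hβ : 0 ≤ β) (hσ : 0 ≤ σ) (hG : ∀ s ≥ 0, G s ≤ β + σ * s) (hpos : 0 ≤ ⟪γ, y⟫_ℝ)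
    (hM : ‖γ‖ ≤ M * (1 + ‖y‖)) (hlarge : 1 ≤ ‖y‖ → m * ‖y‖ ^ 2 ≤ ⟪γ, y⟫_ℝ)
    (hsmall : ‖y‖ ≤ 1 → ‖y‖ ^ 2 + ‖γ‖ ^ 2 ≤ G ⟪γ, y⟫_ℝ) :
    ‖y‖ ^ 2 + ‖γ‖ ^ 2 ≤ β + (σ + (1 + 4 * M ^ 2) / m) * ⟪γ, y⟫_ℝ := by
  have hσpos := mul_nonneg hσ hpos
  rcases le_total ‖y‖ 1 with hy | hy
  · have hK : 0 ≤ (1 + 4 * M ^ 2) / m * ⟪γ, y⟫_ℝ := by positivity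
    linarith [hsmall hy, hG _ hpos]
  · have hγ : ‖γ‖ ^ 2 ≤ 4 * M ^ 2 * ‖y‖ ^ 2 := by
      calc ‖γ‖ ^ 2 ≤ (M * (1 + ‖y‖)) ^ 2 := by gcongr
        _ = M ^ 2 * (1 + ‖y‖) ^ 2 := mul_pow _ _ _
        _ ≤ M ^ 2 * (‖y‖ + ‖y‖) ^ 2 := by gcongr
        _ = 4 * M ^ 2 * ‖y‖ ^ 2 := by ring
    calc ‖y‖ ^ 2 + ‖γ‖ ^ 2 ≤ (1 + 4 * M ^ 2) / m * (m * ‖y‖ ^ 2) := by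
          rw [← mul_assoc, div_mul_cancel₀ _ hm.ne']; linarith
      _ ≤ (1 + 4 * M ^ 2) / m * ⟪γ, y⟫_ℝ := by gcongr; exact hlarge hy
      _ ≤ β + (σ + (1 + 4 * M ^ 2) / m) * ⟪γ, y⟫_ℝ := by linarith

end Pointwise

namespace DampedSystem

variable {J : ℕ} {N : Fin J → ℕ}
  {V H : Type*} [NormedAddCommGroup V] [InnerProductSpace ℝ V] [CompleteSpace V]
  [NormedAddCommGroup H] [InnerProductSpace ℝ H] [CompleteSpace H]
  {X : Fin J → Type*} [∀ j, MetricSpace (X j)] [∀ j, MeasurableSpace (X j)]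
  [∀ j, OpensMeasurableSpace (X j)] (P : DampedSystem N V H X)

/-- The squared `L²` norms of the observations `(I_U v) j` and of their images under the feedbacks,
summed over `j`: the quantity that mediates between the source and the dissipation. -/
noncomputable def observation (v : V) : ℝ :=
  ∑ j, ∫ x, (‖P.comp v j x‖ ^ 2 + ‖P.g j (P.comp v j x)‖ ^ 2) ∂(P.μ j)

theorem memLp_comp (v : V) (j : Fin J) : MemLp (P.comp v j) 2 (P.μ j) := Lp.memLp _

theorem inner_IU (v w : V) :
    ⟪P.IU v, P.IU w⟫_ℝ = ∑ j, ∫ x, ⟪P.comp v j x, P.comp w j x⟫_ℝ ∂(P.μ j) := by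
  simp only [PiLp.inner_apply, Submodule.coe_inner, L2.inner_def, comp]

theorem continuous_α {t : ℝ} (ht : 0 ≤ t) (j : Fin J) : Continuous (P.α j t) :=
  (P.α_continuous j).comp_continuous (f := fun x => (t, x)) (by fun_prop) fun _ => ⟨ht, mem_univ _⟩

theorem inner_g_nonneg (j : Fin J) (y : EuclideanSpace ℝ (Fin (N j))) : 0 ≤ ⟪P.g j y, y⟫_ℝ := by
  simpa only [P.g_zero, sub_zero] using P.g_monotone j y 0

theorem damping_self_nonneg {t : ℝ} (ht : 0 ≤ t) (v : V) : 0 ≤ P.damping t v v :=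
  Finset.sum_nonneg fun j _ => integral_nonneg fun x =>
    mul_nonneg (P.α_pos j t x ht).le (P.inner_g_nonneg j _)

variable {P} {M : ℝ} (hM : ∀ j y, ‖P.g j y‖ ≤ M * (1 + ‖y‖))
include hM

theorem memLp_g_comp (v : V) (j : Fin J) : MemLp (fun x => P.g j (P.comp v j x)) 2 (P.μ j) :=
  have := P.μ_finite j
  memLp_comp_of_linear_growth (P.memLp_comp v j) (P.g_continuous j) (hM j)

theorem integrable_observation (v : V) (j : Fin J) :
    Integrable (fun x => ‖P.comp v j x‖ ^ 2 + ‖P.g j (P.comp v j x)‖ ^ 2) (P.μ j) :=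
  (P.memLp_comp v j).norm.integrable_sq.add (memLp_g_comp hM v j).norm.integrable_sq

variable {t α' : ℝ} (ht : 0 ≤ t) (hα' : ∀ j x, P.α j t x ≤ α')
include ht hα'

theorem integrable_damping (v w : V) (j : Fin J) :
    Integrable (fun x => P.α j t x * ⟪P.g j (P.comp v j x), P.comp w j x⟫_ℝ) (P.μ j) := by
  refine (integrable_inner_of_memLp (memLp_g_comp hM v j) (P.memLp_comp w j)).bdd_mul (c := α')
    (P.continuous_α ht j).measurable.aestronglyMeasurable (ae_of_all _ fun x => ?_)
  rw [Real.norm_of_nonneg (P.α_pos j t x ht).le]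
  exact hα' j x

theorem source_le_observation (v w : V) :
    -P.damping t v w + ⟪P.IU v, P.IU w⟫_ℝ - ⟪P.IU w, P.IU w⟫_ℝ ≤
      (1 + α' ^ 2) / 4 * P.observation v := by
  rw [damping, observation, inner_IU, inner_IU, ← Finset.sum_neg_distrib,
    ← Finset.sum_add_distrib, ← Finset.sum_sub_distrib, Finset.mul_sum]
  refine Finset.sum_le_sum fun j _ => ?_
  have hdamping : Integrable (fun x => -(P.α j t x * ⟪P.g j (P.comp v j x), P.comp w j x⟫_ℝ))
      (P.μ j) := (integrable_damping hM ht hα' v w j).neg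
  have hvw := integrable_inner_of_memLp (P.memLp_comp v j) (P.memLp_comp w j)
  have hww := integrable_inner_of_memLp (P.memLp_comp w j) (P.memLp_comp w j)
  rw [← integral_neg, ← integral_add' hdamping hvw, ← integral_sub' (hdamping.add hvw) hww,
    ← integral_const_mul]
  exact integral_mono ((hdamping.add hvw).sub hww) ((integrable_observation hM v j).const_mul _)
    fun x => neg_mul_inner_add_inner_sub_inner_le _ _ _ (P.α_pos j t x ht).le (hα' j x)

variable {α₀ : ℝ} (hα₀ : 0 < α₀) (hα : ∀ j x, α₀ ≤ P.α j t x)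
include hα₀ hα

theorem observation_le_damping {β γ : ℝ} (hγ : 0 ≤ γ)
    (hgrowth : ∀ j y, ‖y‖ ^ 2 + ‖P.g j y‖ ^ 2 ≤ β + γ * ⟪P.g j y, y⟫_ℝ) (v : V) :
    P.observation v ≤ (∑ j, (P.μ j).real univ) * β + γ / α₀ * P.damping t v v := by
  rw [damping, observation, Finset.sum_mul, Finset.mul_sum, ← Finset.sum_add_distrib]
  refine Finset.sum_le_sum fun j _ => ?_
  have := P.μ_finite j
  have hdamping := (integrable_damping hM ht hα' v v j).const_mul (γ / α₀)
  rw [← smul_eq_mul _ β, ← integral_const, ← integral_const_mul,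
    ← integral_add (integrable_const β) hdamping]
  refine integral_mono (integrable_observation hM v j) ((integrable_const β).add hdamping)
    fun x => (hgrowth j (P.comp v j x)).trans (add_le_add_right ?_ β)
  calc γ * ⟪P.g j (P.comp v j x), P.comp v j x⟫_ℝ
      = γ / α₀ * (α₀ * ⟪P.g j (P.comp v j x), P.comp v j x⟫_ℝ) := by field_simp
    _ ≤ γ / α₀ * (P.α j t x * ⟪P.g j (P.comp v j x), P.comp v j x⟫_ℝ) := by
        gcongr
        exacts [P.inner_g_nonneg j _, hα j x]

theorem inner_neg_sub_le_of_growth {β γ : ℝ} (hγ : 0 ≤ γ)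
    (hgrowth : ∀ j y, ‖y‖ ^ 2 + ‖P.g j y‖ ^ 2 ≤ β + γ * ⟪P.g j y, y⟫_ℝ) {u f z z' : H}
    (hu : P.opGraph t u f) (hz : P.graphForward z z') :
    ⟪-f - z', u - z⟫_ℝ ≤ (1 + α' ^ 2) / 4 * (∑ j, (P.μ j).real univ) * β +
      (1 + α' ^ 2) / 4 / α₀ * γ * ⟪f, u⟫_ℝ := by
  obtain ⟨v, rfl, hv⟩ := hu
  obtain ⟨y, rfl, hy⟩ := hz
  have hskew : P.A₁ v (v - y) = P.A₁ y (v - y) := by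
    rw [← sub_eq_zero, ← sub_apply, ← map_sub, P.A₁_skew]
  have hIU : ⟪P.IU v, P.IU (v - y)⟫_ℝ - ⟪P.IU (v - y), P.IU (v - y)⟫_ℝ =
      ⟪P.IU y, P.IU (v - y)⟫_ℝ := by
    rw [← inner_sub_left, P.IU.map_sub, sub_sub_cancel]
  have hf : P.damping t v v = ⟪f, P.ι v⟫_ℝ := by rw [← hv v, P.A₁_skew, zero_add]
  calc ⟪-f - z', P.ι v - P.ι y⟫_ℝ
      = -P.damping t v (v - y) + ⟪P.IU v, P.IU (v - y)⟫_ℝ -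
          ⟪P.IU (v - y), P.IU (v - y)⟫_ℝ := by
        rw [← map_sub, inner_sub_left, inner_neg_left, ← hv, ← hy, hskew, ← hIU]; ring
    _ ≤ (1 + α' ^ 2) / 4 * P.observation v := source_le_observation hM ht hα' v (v - y)
    _ ≤ (1 + α' ^ 2) / 4 * ((∑ j, (P.μ j).real univ) * β + γ / α₀ * P.damping t v v) := by
        gcongr
        exact observation_le_damping hM ht hα' hα₀ hα hγ hgrowth v
    _ = _ := by rw [hf]; ring

omit hM ht hα' hα₀ hα

theorem inner_nonneg_of_opGraph (ht : 0 ≤ t) {u f : H} (hu : P.opGraph t u f) :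
    0 ≤ ⟪f, u⟫_ℝ := by
  obtain ⟨v, rfl, hv⟩ := hu
  rw [← hv v, P.A₁_skew, zero_add]
  exact P.damping_self_nonneg ht v

theorem IsSolution.exists_hasRightDeriv {x : ℝ → H} (hx : P.IsSolution x) :
    ∃ f : ℝ → H, (∀ t ≥ 0, P.opGraph t (x t) (f t)) ∧ HasRightDerivOffCountable x (-f) 0 := by
  obtain ⟨hcont, f, hf, Z, hZ, hderiv⟩ := hx
  exact ⟨f, hf, hcont, Z, hZ, fun t ht =>
    (hderiv t ht).1.mono (Ioi_subset_Ici ht.1)⟩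

theorem IsSolution.energy_eq_zero {x : ℝ → H} (hx : P.IsSolution x) (hx₀ : energy x 0 = 0)
    (ht : 0 ≤ t) : energy x t = 0 := by
  obtain ⟨f, hf, hderiv⟩ := hx.exists_hasRightDeriv
  have hanti := antitoneOn_energy hderiv fun s hs => inner_nonneg_of_opGraph hs (hf s hs)
  exact le_antisymm (hx₀ ▸ hanti self_mem_Ici ht ht) (energy_nonneg x t)

theorem IsSolution.energy_le_psiInv {x : ℝ → H} (hx : P.IsSolution x) {S : ℝ → H →L[ℝ] H}
    (hS : IsContractionSemigroup S) (hgen : IsGenerator P.graphForward S) {T q : ℝ} (hT : 0 < T)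
    (hST : ‖S T‖ ≤ q) (hq : q < 1) {α₀ α' M m μtot : ℝ} (hα₀ : 0 < α₀) (hm : 0 < m)
    (hμ : ∑ j, (P.μ j).real univ ≤ μtot) (hM : ∀ j y, ‖P.g j y‖ ≤ M * (1 + ‖y‖))
    (hlarge : ∀ j y, 1 ≤ ‖y‖ → m * ‖y‖ ^ 2 ≤ ⟪P.g j y, y⟫_ℝ) {G : ℝ → ℝ}
    (hG : ConcaveOn ℝ (Ici 0) G) (hmono : MonotoneOn G (Ici 0)) (hG₀ : G 0 = 0)
    (hcont : ContinuousOn G (Ici 0))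
    (hsmall : ∀ j y, ‖y‖ ≤ 1 → ‖y‖ ^ 2 + ‖P.g j y‖ ^ 2 ≤ G ⟪P.g j y, y⟫_ℝ)
    (hα : ∀ j t x, 0 ≤ t → α₀ ≤ P.α j t x ∧ P.α j t x ≤ α') (hx₀ : 0 < energy x 0)
    {κ ν : ℝ} (hκ : 0 < κ) (hν : 0 ≤ ν) (hνκ : ν ≤ κ) {t : ℝ} (ht : T ≤ t) :
    energy x t ≤ psiInv (decayConst κ q T ((1 + α' ^ 2) / 4 * μtot) ((1 + α' ^ 2) / 4 / α₀)
      ((1 + 4 * M ^ 2) / m)) G (energy x 0) (ν / T * (t - T)) := by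
  have hμtot : 0 ≤ μtot := (Finset.sum_nonneg fun _ _ => measureReal_nonneg).trans hμ
  have hK : 0 ≤ (1 + 4 * M ^ 2) / m := by positivity
  obtain ⟨f, hf, hderiv⟩ := hx.exists_hasRightDeriv
  refine HyperbolicDamping.energy_le_psiInv hderiv hS hST hq hG hmono hG₀ (by positivity)
    (by positivity) hK (fun s hs z z' hz β σ hβ hσ hGβ => ?_)
    (fun s hs => inner_nonneg_of_opGraph hs (hf s hs)) hT hκ hcont hx₀ hν hνκ ht
  have hgrowth : ∀ j y, ‖y‖ ^ 2 + ‖P.g j y‖ ^ 2 ≤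
      β + (σ + (1 + 4 * M ^ 2) / m) * ⟪P.g j y, y⟫_ℝ := fun j y =>
    norm_sq_add_norm_sq_le_of_growth hm hβ hσ hGβ (P.inner_g_nonneg j y) (hM j y) (hlarge j y)
      (hsmall j y)
  refine (inner_neg_sub_le_of_growth hM hs (fun j y => (hα j s y hs).2) hα₀
    (fun j y => (hα j s y hs).1) (add_nonneg hσ hK) hgrowth (hf s hs)
    ((hgen.iff_hasDerivWithinAt hS).2 hz)).trans ?_
  gcongr

end DampedSystem

theorem exists_forall_ge_mul_exp_le (C : ℝ) {ω ε : ℝ} (hω : 0 < ω) (hε : 0 < ε) :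
    ∃ T₀ > 0, ∀ T ≥ T₀, C * Real.exp (-ω * T) ≤ ε := by
  have hlim : Tendsto (fun T => C * Real.exp (-ω * T)) atTop (𝓝 (C * 0)) :=
    (Real.tendsto_exp_atBot.comp
      (tendsto_id.const_mul_atTop_of_neg (neg_neg_of_pos hω))).const_mul C
  rw [mul_zero] at hlim
  obtain ⟨T₁, hT₁⟩ := eventually_atTop.1 (hlim.eventually_le_const hε)
  exact ⟨max 1 T₁, by positivity, fun T hT => hT₁ T ((le_max_right _ _).trans hT)⟩

theorem DampedSystem.LinearlyStable.exists_norm_le {J : ℕ} {N : Fin J → ℕ}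
    {V H : Type*} [NormedAddCommGroup V] [InnerProductSpace ℝ V] [CompleteSpace V]
    [NormedAddCommGroup H] [InnerProductSpace ℝ H] [CompleteSpace H]
    {X : Fin J → Type*} [∀ j, MetricSpace (X j)] [∀ j, MeasurableSpace (X j)]
    [∀ j, OpensMeasurableSpace (X j)] {P : DampedSystem N V H X} {C ω T q : ℝ}
    (hP : P.LinearlyStable C ω) (hT : 0 ≤ T) (hq : 0 ≤ q) (hexp : C * Real.exp (-ω * T) ≤ q) :
    ∃ S : ℝ → H →L[ℝ] H, IsContractionSemigroup S ∧ IsGenerator P.graphForward S ∧ ‖S T‖ ≤ q := by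
  obtain ⟨-, S, hS, hgen, hdecay⟩ := hP
  exact ⟨S, hS, hgen, (S T).opNorm_le_bound hq fun u =>
    (hdecay T hT u).trans (mul_le_mul_of_nonneg_right hexp (norm_nonneg u))⟩

end HyperbolicDamping

open HyperbolicDamping in
theorem mainTheorem3_general (J : ℕ) (hJ : 0 < J) {T q μmax α₀ : ℝ} (α' M : ℝ) {m : ℝ}
    (hT : 0 < T) (hq : q < 1) (hα₀ : 0 < α₀) (hm : 0 < m) :
    ∃ c > 0, ∀ (N : Fin J → ℕ)
      (V H : Type*) [NormedAddCommGroup V] [InnerProductSpace ℝ V] [CompleteSpace V]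
      [NormedAddCommGroup H] [InnerProductSpace ℝ H] [CompleteSpace H]
      (X : Fin J → Type*) [∀ j, MetricSpace (X j)] [∀ j, MeasurableSpace (X j)]
      [∀ j, OpensMeasurableSpace (X j)] (P : DampedSystem N V H X) (G : ℝ → ℝ),
      (∀ j, (P.μ j).real univ ≤ μmax) →
      (∃ S, IsContractionSemigroup S ∧ IsGenerator P.graphForward S ∧ ‖S T‖ ≤ q) →
      (∀ j y, ‖P.g j y‖ ≤ M * (1 + ‖y‖)) →
      (∀ j y, 1 ≤ ‖y‖ → m * ‖y‖ ^ 2 ≤ ⟪P.g j y, y⟫_ℝ) →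
      ConcaveOn ℝ (Ici 0) G → MonotoneOn G (Ici 0) → G 0 = 0 → ContinuousOn G (Ici 0) →
      (∀ j y, ‖y‖ ≤ 1 → ‖y‖ ^ 2 + ‖P.g j y‖ ^ 2 ≤ G ⟪P.g j y, y⟫_ℝ) →
      (∀ j t x, 0 ≤ t → α₀ ≤ P.α j t x ∧ P.α j t x ≤ α') →
      BijOn (hFun c G) (Ici 0) (Ici 0) ∧
      ∀ x : ℝ → H, P.IsSolution x →
        (0 < energy x 0 →
          (∀ y > 0, IntervalIntegrable (fun s => 1 / pFun c G s) volume y (energy x 0)) ∧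
          StrictAntiOn (psi c G (energy x 0)) (Ioi 0) ∧
          SurjOn (psi c G (energy x 0)) (Ioi 0) (Ici 0) ∧
          ∀ t ≥ T, energy x t ≤
            psiInv c G (energy x 0) (T * (⨅ j, (P.μ j).real univ) * α₀ * (t - T))) ∧
        (energy x 0 = 0 → ∀ t ≥ T, energy x t = 0) := by
  -- The `+ 1` keeps this unit of energy loss positive when all the measures vanish.
  have hκ : 0 < T ^ 2 * (|μmax| + 1) * α₀ := by positivity
  have hc := decayConst_pos hκ hq hT.le (A := (1 + α' ^ 2) / 4 * (J * |μmax|))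
    (B := (1 + α' ^ 2) / 4 / α₀) (K := (1 + 4 * M ^ 2) / m) (by positivity) (by positivity)
    (by positivity)
  refine ⟨_, hc, ?_⟩
  rintro N V H _ _ _ _ _ _ X _ _ _ P G hμ ⟨S, hS, hgen, hST⟩ hM hlarge hG hmono hG₀ hcont hsmall hα
  have hsum : ∑ j, (P.μ j).real univ ≤ J * |μmax| := by
    simpa using Finset.sum_le_card_nsmul Finset.univ _ _ fun j _ => (hμ j).trans (le_abs_self _)
  have : Nonempty (Fin J) := ⟨⟨0, hJ⟩⟩
  have hinf : ⨅ j, (P.μ j).real univ ≤ |μmax| + 1 :=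
    (ciInf_le (finite_range _).bddBelow ⟨0, hJ⟩).trans (by linarith [hμ ⟨0, hJ⟩, le_abs_self μmax])
  have hinf₀ : 0 ≤ ⨅ j, (P.μ j).real univ := le_ciInf fun _ => measureReal_nonneg
  refine ⟨bijOn_hFun hc hmono hG₀ hcont, fun x hx => ⟨fun hx₀ => ⟨fun y hy => ?_,
    strictAntiOn_psi hc hmono hG₀ hcont hx₀, surjOn_psi hc hmono hG₀ hcont hx₀, fun t ht => ?_⟩,
    fun hx₀ t ht => hx.energy_eq_zero hx₀ (hT.le.trans ht)⟩⟩
  · exact intervalIntegrable_of_antitoneOn_Ioi (antitoneOn_one_div_pFun hc hmono hG₀ hcont) hy hx₀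
  · have hrate : T * (⨅ j, (P.μ j).real univ) * α₀ =
        T ^ 2 * (⨅ j, (P.μ j).real univ) * α₀ / T := by field_simp
    rw [hrate]
    exact hx.energy_le_psiInv hS hgen hT hST hq hα₀ hm hsum hM hlarge hG hmono hG₀ hcont hsmall hα
      hx₀ hκ (by positivity) (by gcongr) ht

theorem mainTheorem3 (J : ℕ) (hJ : 0 < J) (C ω : ℝ) (hC : 0 < C) (hω : 0 < ω) :
    ∃ T₀ > 0, ∀ T ≥ T₀, ∀ μmax α₀ α' M m : ℝ, 0 < α₀ → 0 < α' → 0 < M → 0 < m →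
      ∃ c > 0, ∀ (N : Fin J → ℕ)
        (V H : Type*) [NormedAddCommGroup V] [InnerProductSpace ℝ V] [CompleteSpace V]
        [NormedAddCommGroup H] [InnerProductSpace ℝ H] [CompleteSpace H]
        (X : Fin J → Type*) [∀ j, MetricSpace (X j)] [∀ j, MeasurableSpace (X j)]
        [∀ j, OpensMeasurableSpace (X j)]
        (P : HyperbolicDamping.DampedSystem N V H X) (G : ℝ → ℝ),
        ⨆ j, (P.μ j).real univ = μmax →
        P.LinearlyStable C ω →
        (∀ j y, ‖P.g j y‖ ≤ M * (1 + ‖y‖)) →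
        (∀ j y, 1 ≤ ‖y‖ → m * ‖y‖ ^ 2 ≤ ⟪P.g j y, y⟫_ℝ) →
        ConcaveOn ℝ (Ici 0) G → StrictMonoOn G (Ici 0) → G 0 = 0 → ContinuousOn G (Ici 0) →
        (∀ j y, ‖y‖ ≤ 1 → ‖y‖ ^ 2 + ‖P.g j y‖ ^ 2 ≤ G ⟪P.g j y, y⟫_ℝ) →
        (∀ j t x, 0 ≤ t → α₀ ≤ P.α j t x ∧ P.α j t x ≤ α') →
        -- `h` is invertible on `[0, ∞)`, so that `p = h⁻¹` is well defined
        BijOn (HyperbolicDamping.hFun c G) (Ici 0) (Ici 0) ∧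
        ∀ x : ℝ → H, P.IsSolution x →
          (0 < HyperbolicDamping.energy x 0 →
            -- `ψ` is well defined on `(0, ∞)` and has an inverse defined on `[0, ∞)`
            (∀ y > 0, IntervalIntegrable (fun s => 1 / HyperbolicDamping.pFun c G s) volume
              y (HyperbolicDamping.energy x 0)) ∧
            StrictAntiOn (HyperbolicDamping.psi c G (HyperbolicDamping.energy x 0)) (Ioi 0) ∧
            SurjOn (HyperbolicDamping.psi c G (HyperbolicDamping.energy x 0)) (Ioi 0) (Ici 0) ∧
            ∀ t ≥ T, HyperbolicDamping.energy x t ≤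
              HyperbolicDamping.psiInv c G (HyperbolicDamping.energy x 0)
                (T * (⨅ j, (P.μ j).real univ) * α₀ * (t - T))) ∧
          (HyperbolicDamping.energy x 0 = 0 → ∀ t ≥ T, HyperbolicDamping.energy x t = 0) := by
  obtain ⟨T₀, hT₀, hexp⟩ := HyperbolicDamping.exists_forall_ge_mul_exp_le C hω one_half_pos
  refine ⟨T₀, hT₀, fun T hT μmax α₀ α' M m hα₀ _ _ hm => ?_⟩
  have hT' : 0 < T := hT₀.trans_le hT
  obtain ⟨c, hc, hdecay⟩ := mainTheorem3_general J hJ α' M hT' one_half_lt_one hα₀ hm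
  exact ⟨c, hc, fun N V H _ _ _ _ _ _ X _ _ _ P G hμ hP hM hg hG hmono =>
    hdecay N V H X P G (fun j => hμ ▸ le_ciSup (f := fun j => (P.μ j).real univ)
      (finite_range _).bddAbove j) (hP.exists_norm_le hT'.le one_half_pos.le (hexp T hT))
      hM hg hG hmono.monotoneOn⟩
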